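/- Let $(x \in X)$ be any singularity, i.e. a germ of a (not necessarily reduced) complex space over $\mathbb{C}$, and let $e = \dim_{\mathbb{C}} \mathfrak{m}_x/\mathfrak{m}_x^2$ be its embedding dimension, where $\mathfrak{m}_x$ is the maximal ideal of $\mathcal{O}_{X,x}$. Locally $X$ is the zero set of finitely many holomorphic functions $f_1,\dots,f_r$ on an open set $U \subseteq \mathbb{C}^n$, with $\mathcal{O}_X = \mathcal{O}_U/(f_1,\dots,f_r)$; let $$\Omega_X^1 = \Omega_U^1|_X \big/ \langle \mathrm{d}f_1,\dots,\mathrm{d}f_r\rangle, \qquad \Omega_X^p = \textstyle\bigwedge^p \Omega_X^1$$ be the sheaves of Kähler differential forms on $X$. If $\Omega_X^p$ is free on a neighbourhood of $x$ for some integer $p$ with $1 \le p \le e$, then $(x \in X)$ is smooth, i.e. some neighbourhood of $x$ in $X$ is isomorphic, as a complex space, to an open subset of $\mathbb{C}^d$ for some $d$. -/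

import Mathlib

open Filter Topology TopologicalSpace

noncomputable section

/-- Germs of functions with values in `ℂ` form a `ℂ`-algebra (for pointwise scalar multiplication). -/
instance germAlgebra {n : ℕ} (y : Fin n → ℂ) : Algebra ℂ (Germ (𝓝 y) ℂ) :=
  Algebra.ofModule
    (fun c a b => by
      induction a using Quotient.inductionOn with | _ a => ?_
      induction b using Quotient.inductionOn with | _ b => ?_
      exact congrArg (fun u : (Fin n → ℂ) → ℂ => (u : Germ (𝓝 y) ℂ)) (smul_mul_assoc c a b))
    (fun c a b => by
      induction a using Quotient.inductionOn with | _ a => ?_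
      induction b using Quotient.inductionOn with | _ b => ?_
      exact congrArg (fun u : (Fin n → ℂ) → ℂ => (u : Germ (𝓝 y) ℂ)) (mul_smul_comm c a b))

/-- The `ℂ`-algebra `𝒪_{ℂⁿ, y}` of germs at `y` of holomorphic functions on `ℂⁿ`. -/
def holGerms {n : ℕ} (y : Fin n → ℂ) : Subalgebra ℂ (Germ (𝓝 y) ℂ) where
  carrier := {a | ∃ g : (Fin n → ℂ) → ℂ, AnalyticAt ℂ g y ∧ (g : Germ (𝓝 y) ℂ) = a}
  mul_mem' := by
    rintro _ _ ⟨g, hg, rfl⟩ ⟨h, hh, rfl⟩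
    exact ⟨g * h, hg.mul hh, rfl⟩
  add_mem' := by
    rintro _ _ ⟨g, hg, rfl⟩ ⟨h, hh, rfl⟩
    exact ⟨g + h, hg.add hh, rfl⟩
  algebraMap_mem' := fun c =>
    ⟨fun _ => c, analyticAt_const, by
      rw [Algebra.algebraMap_eq_smul_one, ← Germ.coe_one, ← Germ.coe_smul]
      congr 1
      funext z
      simp⟩

/-- The germ at `y` of a function which is holomorphic near `y`. -/
def holGerm {n : ℕ} {y : Fin n → ℂ} (g : (Fin n → ℂ) → ℂ) (hg : AnalyticAt ℂ g y) : holGerms y :=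
  ⟨(g : Germ (𝓝 y) ℂ), g, hg, rfl⟩

/-- The partial derivative `∂g/∂zᵢ` of a function on `ℂⁿ`. -/
def partialDeriv {n : ℕ} (i : Fin n) (g : (Fin n → ℂ) → ℂ) : (Fin n → ℂ) → ℂ :=
  fun z => fderiv ℂ g z (Pi.single i 1)

theorem analyticAt_partialDeriv {n : ℕ} (i : Fin n) {g : (Fin n → ℂ) → ℂ} {y : Fin n → ℂ}
    (hg : AnalyticAt ℂ g y) : AnalyticAt ℂ (partialDeriv i g) y :=
  ((ContinuousLinearMap.apply ℂ ℂ (Pi.single i (1 : ℂ) : Fin n → ℂ)).analyticAt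
    (fderiv ℂ g y)).comp hg.fderiv

/-- The data defining a (not necessarily reduced) closed complex subspace of an open set in `ℂⁿ`:
an open set `U` and finitely many holomorphic functions `f₁, …, f_r` on `U`. The complex space is
the zero set `X = {f₁ = ⋯ = f_r = 0} ⊆ U` with structure sheaf `𝒪_U / (f₁, …, f_r)` restricted
to `X`. By definition, every complex space is locally of this form, so that the germs
`(X, x)` with `x ∈ X` are all germs of complex spaces. -/
structure AnalyticModel (n r : ℕ) where
  /-- the ambient open set -/
  U : Opens (Fin n → ℂ)
  /-- the defining equations -/
  f : Fin r → (Fin n → ℂ) → ℂ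
  /-- the equations are holomorphic on `U` -/
  analytic : ∀ j, AnalyticOnNhd ℂ (f j) U

namespace AnalyticModel

variable {n r : ℕ} (X : AnalyticModel n r)

/-- The underlying topological space of `X`, with the topology induced from `ℂⁿ`. -/
abbrev Pt : Type := {z : Fin n → ℂ // z ∈ X.U ∧ ∀ j, X.f j z = 0}

theorem analyticAt (j : Fin r) (y : X.Pt) : AnalyticAt ℂ (X.f j) y.1 := X.analytic j y.1 y.2.1

/-- The stalk at `y` of the ideal sheaf of `X`, generated by the germs of the equations. -/
def ideal (y : X.Pt) : Ideal (holGerms y.1) :=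
  Ideal.span (Set.range fun j => holGerm (X.f j) (X.analyticAt j y))

/-- The stalk `𝒪_{X, y} = 𝒪_{ℂⁿ, y} / (f₁, …, f_r)` of the structure sheaf. -/
def Stalk (y : X.Pt) : Type := holGerms y.1 ⧸ X.ideal y

instance (y : X.Pt) : CommRing (X.Stalk y) :=
  inferInstanceAs (CommRing (holGerms y.1 ⧸ X.ideal y))

instance (y : X.Pt) : Algebra ℂ (X.Stalk y) :=
  inferInstanceAs (Algebra ℂ (holGerms y.1 ⧸ X.ideal y))

/-- The projection `𝒪_{ℂⁿ, y} → 𝒪_{X, y}`. -/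
def proj (y : X.Pt) : holGerms y.1 →ₐ[ℂ] X.Stalk y := Ideal.Quotient.mkₐ ℂ (X.ideal y)

/-- The germ at `y ∈ X` of the function on `X` induced by a holomorphic function `g` on the
ambient space. -/
def germ {y : X.Pt} (g : (Fin n → ℂ) → ℂ) (hg : AnalyticAt ℂ g y.1) : X.Stalk y :=
  X.proj y (holGerm g hg)

/-- The maximal ideal `𝔪_y` of `𝒪_{X, y}`: the germs vanishing at `y`. -/
def maxIdeal (y : X.Pt) : Ideal (X.Stalk y) :=
  Ideal.span {a | ∃ (g : (Fin n → ℂ) → ℂ) (hg : AnalyticAt ℂ g y.1), g y.1 = 0 ∧ X.germ g hg = a}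

/-- The embedding dimension `dim_ℂ 𝔪_y / 𝔪_y²` of the germ `(X, y)`. -/
def embDim (y : X.Pt) : ℕ := Module.finrank ℂ (X.maxIdeal y).Cotangent

/-- The differential `dg = ∑ᵢ (∂g/∂zᵢ) dzᵢ`, restricted to `X`, of a function `g` holomorphic
near `y`, as an element of the free module `Ω¹_{ℂⁿ}|_X` at `y` with basis `dz₁, …, dz_n`. -/
def ambientD {y : X.Pt} (g : (Fin n → ℂ) → ℂ) (hg : AnalyticAt ℂ g y.1) : Fin n → X.Stalk y :=
  fun i => X.germ (partialDeriv i g) (analyticAt_partialDeriv i hg)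

/-- The stalk at `y` of the sheaf of Kähler `1`-forms
`Ω¹_X = Ω¹_{ℂⁿ}|_X / ⟨df₁, …, df_r⟩`. -/
abbrev Omega1 (y : X.Pt) : Type :=
  (Fin n → X.Stalk y) ⧸
    Submodule.span (X.Stalk y) (Set.range fun j => X.ambientD (X.f j) (X.analyticAt j y))

/-- The class of the coordinate differential `dzᵢ` in `Ω¹_{X, y}`. -/
def dz (y : X.Pt) (i : Fin n) : X.Omega1 y :=
  Submodule.Quotient.mk (Pi.single i 1)

/-- The stalk at `y` of the sheaf of Kähler `p`-forms `Ω^p_X = ⋀^p Ω¹_X`. -/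
abbrev Omega (p : ℕ) (y : X.Pt) : Type := ⋀[X.Stalk y]^p (X.Omega1 y)

/-- Sections of the sheaf `Ω^p_X` over an open set `S ⊆ X`: the families of elements of the stalks
which near each point of `S` are induced by a holomorphic `p`-form
`∑_J a_J dz_{J₁} ∧ ⋯ ∧ dz_{J_p}` on an open set of the ambient space. -/
def IsFormSection {p : ℕ} {S : Opens X.Pt} (ω : ∀ y : S, X.Omega p y.1) : Prop :=
  ∀ y : S, ∃ a : (Fin p → Fin n) → (Fin n → ℂ) → ℂ,
    ∀ᶠ z : S in 𝓝 y, ∃ ha : ∀ J, AnalyticAt ℂ (a J) z.1.1,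
      ω z = ∑ J, X.germ (a J) (ha J) •
        exteriorPower.ιMulti (X.Stalk z.1) p (fun k => X.dz z.1 (J k))

/-- The sheaf `Ω^p_X` is free on the germ `(X, x)`: on some open neighbourhood `S` of `x` there is a
frame, that is, there are sections `ω₁, …, ω_m` of `Ω^p_X` over `S` that form a basis of the stalk
at every point of `S` (equivalently, the map `𝒪_S^m → Ω^p_X|_S` which they define is an
isomorphism of sheaves). -/
def IsFreeOmega (p : ℕ) (x : X.Pt) : Prop :=
  ∃ (S : Opens X.Pt) (m : ℕ) (ω : Fin m → ∀ y : S, X.Omega p y.1),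
    x ∈ S ∧ (∀ i, X.IsFormSection (ω i)) ∧
      ∀ y : S, LinearIndependent (X.Stalk y.1) (fun i => ω i y) ∧
        Submodule.span (X.Stalk y.1) (Set.range fun i => ω i y) = ⊤

/-- The germ `(X, x)` is smooth: some open neighbourhood `S` of `x` in `X` is isomorphic, as a
`ℂ`-ringed space, to an open subset `D` of some `ℂ^d` with its sheaf of holomorphic functions.
The isomorphism consists of a homeomorphism `φ : S ≃ D` and isomorphisms of `ℂ`-algebras
`θ_y : 𝒪_{ℂ^d, φ(y)} ≃ 𝒪_{X, y}` that form a morphism of sheaves, i.e. that send every section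
(the germs of a holomorphic function `h`) to a section (locally the germs on `X` of
a holomorphic function `g` on the ambient space). -/
def IsSmoothAt (x : X.Pt) : Prop :=
  ∃ (d : ℕ) (S : Opens X.Pt) (D : Opens (Fin d → ℂ)) (φ : S ≃ₜ D)
    (θ : ∀ y : S, holGerms (φ y).1 ≃ₐ[ℂ] X.Stalk y.1),
    x ∈ S ∧ ∀ (y : S) (h : (Fin d → ℂ) → ℂ), AnalyticAt ℂ h (φ y).1 →
      ∃ g : (Fin n → ℂ) → ℂ, ∀ᶠ z : S in 𝓝 y,
        ∃ (hh : AnalyticAt ℂ h (φ z).1) (hg : AnalyticAt ℂ g z.1.1),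
          θ z (holGerm h hh) = X.germ g hg

end AnalyticModel

end

/-!
Let `A = 𝒪_{X, x}`, let `J` be the Jacobian matrix of the equations `f`, and let `e` be the corank of
`J` at `x`. The module `Ω¹_{X, x}`, the cokernel of the transpose of `J` over `A`, is generated by `e`
differentials which are independent over the residue field `ℂ`, and `e` is at least the embedding
dimension (`AnalyticModel.embDim_le`), so that `p ≤ e`.

Since `⋀^p A^e → ⋀^p Ω¹` is a surjection onto a free module of rank at least `e.choose p`, it is
injective. Wedging a relation between the `e` generators with `p - 1` basis vectors shows that the
relation is trivial, so that `Ω¹_{X, x}` is itself free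
(`injective_of_basis_exteriorPower`). Only the stalk at `x` enters here.

Choose a matrix `B` such that `B f` consists, up to redundancy, of `n - e` combinations of the
equations with independent differentials at `x`. Freeness of `Ω¹` means that every `df_j` is a
combination of the differentials of `B f` modulo the ideal of `X`
(`AnalyticModel.exists_partialDeriv_eq`). Let `ψ` parametrize the submanifold `B f = 0`.
Then the functions `f_j ∘ ψ` satisfy a homogeneous linear differential equation and vanish at one
point, so they vanish identically (`AnalyticModel.eventually_comp_eq_zero`), by Grönwall's inequality.
Hence `X` is near `x` the submanifold `B f = 0`, and by Hadamard's lemma (`exists_hadamard`) also its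
structure sheaf is that of the submanifold (`AnalyticModel.isSmoothAt_of_parametrization`).
-/

noncomputable section

/-! ### Freeness of exterior powers -/

section
variable {A k M : Type*} [CommRing A] [Field k] [AddCommGroup M] [Module A M]

open exteriorPower in
/-- A vector `v` of a free module of rank `e ≥ p` vanishes if `v ∧ e_{κ 1} ∧ ⋯ ∧ e_{κ (p - 1)} = 0`
for all choices of `p - 1` standard basis vectors. -/
theorem eq_zero_of_ιMulti_ite_eq_zero [Nontrivial A] {e p : ℕ} (hp : 1 ≤ p) (hpe : p ≤ e)
    (v : Fin e → A)
    (h : ∀ κ : Fin p → Fin e,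
      ιMulti A p (fun a => if (a : ℕ) = 0 then v else Pi.single (κ a) 1) = 0) : v = 0 := by
  funext i
  obtain ⟨p, rfl⟩ : ∃ q, p = q + 1 := ⟨p - 1, by omega⟩
  -- an injection of the `p` positions into the coordinates which sends the first to `i`
  obtain ⟨κ, hκ, hi⟩ : ∃ κ : Fin (p + 1) → Fin e, Function.Injective κ ∧ κ 0 = i := by
    refine ⟨Equiv.swap (Fin.castLE hpe 0) i ∘ Fin.castLE hpe,
      (Equiv.injective _).comp (Fin.castLE_injective hpe), by simp⟩
  -- the minor of the columns `κ` is upper triangular with diagonal `v i, 1, …, 1`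
  let D : (Fin e → A) [⋀^Fin (p + 1)]→ₗ[A] A :=
    Matrix.detRowAlternating.compLinearMap (LinearMap.funLeft A A κ)
  have h1 := congrArg (alternatingMapLinearEquiv D) (h κ)
  rw [alternatingMapLinearEquiv_apply_ιMulti, map_zero] at h1
  have h2 : Matrix.det (Matrix.of fun a b : Fin (p + 1) =>
      (if (a : ℕ) = 0 then v else Pi.single (κ a) 1) (κ b)) = 0 := h1
  rw [Matrix.det_of_isUpperTriangular] at h2
  · rw [Fin.prod_univ_succ] at h2
    simpa [hi] using h2
  · intro a b hab
    have hab' : b < a := hab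
    have ha : (a : ℕ) ≠ 0 := by
      have := Fin.lt_def.1 hab'
      omega
    simp only [Matrix.of_apply, if_neg ha]
    exact Pi.single_eq_of_ne (fun hh => hab'.ne (hκ hh)) _

open exteriorPower in
/-- If `M` has an `e`-dimensional quotient over a residue field, then a basis of `⋀^p M` has at least
`e.choose p` elements: it spans the `p`-th exterior power of the quotient. -/
theorem choose_le_card_of_basis_exteriorPower (ev : A →+* k) {e p m : ℕ}
    (b : Module.Basis (Fin m) A (⋀[A]^p M))
    (τ : M →ₛₗ[ev] (Fin e → k)) (s : Fin e → M) (hs : ∀ i, τ (s i) = Pi.single i 1) :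
    e.choose p ≤ m := by
  classical
  let _ : Algebra A k := ev.toAlgebra
  let V := ⋀[k]^p (Fin e → k)
  let τ' : M →ₗ[A] (Fin e → k) :=
    { toFun := τ, map_add' := map_add τ, map_smul' := fun a x => by
        rw [map_smulₛₗ]
        funext i
        simp [Algebra.smul_def, RingHom.algebraMap_toAlgebra] }
  let T : ⋀[A]^p M →ₗ[A] V :=
    alternatingMapLinearEquiv
      { (((ιMulti k p (M := Fin e → k)).toMultilinearMap.restrictScalars A).compLinearMap
          fun _ => τ') with
        map_eq_zero_of_eq' := fun v i j hij h =>
          (ιMulti k p (M := Fin e → k)).map_eq_zero_of_eq (fun a => τ (v a)) (congrArg τ hij) h }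
  have hT : ∀ κ : Fin p → Fin e, ιMulti k p (fun a => (Pi.single (κ a) 1 : Fin e → k)) =
      T (ιMulti A p (fun a => s (κ a))) := by
    intro κ
    simp only [T, alternatingMapLinearEquiv_apply_ιMulti]
    change _ = ιMulti k p (fun a => τ (s (κ a)))
    simp [hs]
  have hspan : Submodule.span k (Set.range fun i => T (b i)) = ⊤ := by
    rw [eq_top_iff, ← ιMulti_span_of_span k p (Fin e → k)
      (s := Set.range fun i => (Pi.single i 1 : Fin e → k)) (by
        rw [← (Pi.basisFun k (Fin e)).span_eq]
        congr 2
        funext i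
        simp), Submodule.span_le]
    rintro _ ⟨w, hw, rfl⟩
    choose κ hκ using hw
    have hw' : w = fun a => Pi.single (κ ⟨a, rfl⟩) 1 := funext fun a => (hκ ⟨a, rfl⟩).symm
    rw [SetLike.mem_coe, hw', hT, ← b.sum_repr (ιMulti A p _), map_sum]
    refine Submodule.sum_mem _ fun i _ => ?_
    rw [map_smul, ← algebraMap_smul k]
    exact Submodule.smul_mem _ _ (Submodule.subset_span ⟨i, rfl⟩)
  have h1 := finrank_range_le_card (R := k) fun i => T (b i)
  rw [Set.finrank, hspan, finrank_top, exteriorPower.finrank_eq] at h1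
  simpa using h1

/-- If `M` is generated by `e` elements which stay independent over a residue field, and `⋀^p M` is
free for some `1 ≤ p ≤ e`, then these generators form a basis of `M`. Indeed `⋀^p A^e → ⋀^p M` is
a surjection onto a free module of at least the same rank, hence injective, and wedging a relation
with `p - 1` basis vectors shows that the relation is trivial. -/
theorem injective_of_basis_exteriorPower [Nontrivial A] (ev : A →+* k) {e p m : ℕ}
    (hp : 1 ≤ p) (hpe : p ≤ e)
    (b : Module.Basis (Fin m) A (⋀[A]^p M)) (σ : (Fin e → A) →ₗ[A] M) (hσ : Function.Surjective σ)
    (τ : M →ₛₗ[ev] (Fin e → k)) (hτ : ∀ i, τ (σ (Pi.single i 1)) = Pi.single i 1) :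
    Function.Injective σ := by
  have hm : e.choose p ≤ m := choose_le_card_of_basis_exteriorPower ev b τ _ hτ
  let c := (Pi.basisFun A (Fin e)).exteriorPower (n := p)
  have hc : Fintype.card (Set.powersetCard (Fin e) p) ≤ Fintype.card (Fin m) := by
    rw [← Nat.card_eq_fintype_card, Set.powersetCard.card]
    simpa using hm
  obtain ⟨j⟩ := Function.Embedding.nonempty_of_card_le hc
  have hinj : Function.Injective (exteriorPower.map p σ) := by
    have : Module.Finite A (⋀[A]^p M) := .of_basis b
    refine OrzechProperty.injective_of_surjective_of_injective
      (b.repr.symm.toLinearMap ∘ₗ Finsupp.lmapDomain A A j ∘ₗ c.repr.toLinearMap) _ ?_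
      (exteriorPower.map_surjective hσ)
    exact b.repr.symm.injective.comp
      ((Finsupp.mapDomain_injective j.injective).comp c.repr.injective)
  rw [← LinearMap.ker_eq_bot, Submodule.eq_bot_iff]
  intro v hv
  refine eq_zero_of_ιMulti_ite_eq_zero hp hpe v fun κ => hinj ?_
  rw [map_zero, exteriorPower.map_apply_ιMulti]
  exact (exteriorPower.ιMulti A p).map_coord_zero (⟨0, hp⟩ : Fin p) (by simpa using hv)
end

open Matrix in
/-- Let `J` have entries in a local ring with residue field `k`, reduced rank `n - e`, and cokernel
(of the transpose) with free `p`-th exterior power for some `1 ≤ p ≤ e`. Then the rows of `J` are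
combinations of the rows of `B * J`, where `B` is such that `B * J` reduces to a projection `1 - ι * ρ`
of rank `n - e`. The reason is that the cokernel is free on the `e` rows of `ρ`. -/
theorem exists_eq_mul_of_basis_exteriorPower {A k : Type*} [CommRing A] [Nontrivial A] [Field k]
    (ev : A →+* k) (hu : ∀ a, ev a ≠ 0 → IsUnit a) {r n e p m : ℕ}
    (J : Matrix (Fin r) (Fin n) A) (B : Matrix (Fin n) (Fin r) A) (ι : Matrix (Fin n) (Fin e) A)
    (ρ : Matrix (Fin e) (Fin n) A) (h1 : (B * J + ι * ρ).map ev = 1) (h2 : (ρ * ι).map ev = 1)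
    (h3 : (J * ι).map ev = 0) (hp : 1 ≤ p) (hpe : p ≤ e)
    (b : Module.Basis (Fin m) A
      (⋀[A]^p ((Fin n → A) ⧸ Submodule.span A (Set.range fun j => J j)))) :
    ∃ Q : Matrix (Fin r) (Fin n) A, J = Q * (B * J) := by
  set N := Submodule.span A (Set.range fun j => J j) with hN
  set P := B * J + ι * ρ with hP
  have hdet : IsUnit P.det := by
    refine hu _ ?_
    have : ev P.det = (P.map ev).det := ev.map_det P
    rw [this, h1, det_one]
    exact one_ne_zero
  have hPinv : P⁻¹ * P = 1 := nonsing_inv_mul P hdet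
  have hJN : ∀ u : Fin r → A, u ᵥ* J ∈ N := by
    intro u
    rw [vecMul_eq_sum]
    exact N.sum_mem fun j _ => N.smul_mem _ (Submodule.subset_span ⟨j, rfl⟩)
  -- the `e` generators of the cokernel, and its quotient over the residue field
  let σ : (Fin e → A) →ₗ[A] ((Fin n → A) ⧸ N) := N.mkQ ∘ₗ ρ.vecMulLinear
  have hσ : Function.Surjective σ := by
    intro w
    obtain ⟨w, rfl⟩ := N.mkQ_surjective w
    refine ⟨w ᵥ* (P⁻¹ * ι), ?_⟩
    refine (Submodule.Quotient.eq N).2 ?_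
    have : w = w ᵥ* (P⁻¹ * P) := by rw [hPinv, vecMul_one]
    have h4 : (w ᵥ* (P⁻¹ * ι)) ᵥ* ρ - w = (-(w ᵥ* (P⁻¹ * B))) ᵥ* J := by
      nth_rewrite 2 [this]
      rw [hP, vecMul_vecMul, neg_vecMul, vecMul_vecMul, Matrix.mul_add, vecMul_add]
      simp only [Matrix.mul_assoc, ← hP]
      abel
    rw [show ρ.vecMulLinear (w ᵥ* (P⁻¹ * ι)) = (w ᵥ* (P⁻¹ * ι)) ᵥ* ρ from rfl, h4]
    exact hJN _
  let τ₀ : (Fin n → A) →ₛₗ[ev] (Fin e → k) :=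
    { toFun := fun w => (ev ∘ w) ᵥ* ι.map ev
      map_add' := fun v w => by
        rw [← add_vecMul]
        congr 1
        funext i
        simp
      map_smul' := fun a w => by
        rw [← smul_vecMul]
        congr 1
        funext i
        simp }
  have hτ₀ : N ≤ LinearMap.ker τ₀ := by
    rw [hN, Submodule.span_le]
    rintro _ ⟨j, rfl⟩
    change (ev ∘ J j) ᵥ* ι.map ev = 0
    rw [Matrix.map_mul] at h3
    exact congrFun h3 j
  let τ := N.liftQ τ₀ hτ₀
  have hinj := injective_of_basis_exteriorPower ev hp hpe b σ hσ τ (by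
    intro i
    change (ev ∘ (Pi.single i 1 ᵥ* ρ)) ᵥ* ι.map ev = _
    rw [Matrix.map_mul] at h2
    rw [single_one_vecMul]
    refine (congrFun h2 i).trans (funext fun l => ?_)
    rw [Matrix.one_apply, Pi.single_apply]
    simp only [eq_comm])
  have hJ : J * (P⁻¹ * P) = J := by rw [hPinv, Matrix.mul_one]
  have h5 : J * (P⁻¹ * (B * J)) + J * (P⁻¹ * (ι * ρ)) = J := by
    rw [← Matrix.mul_add, ← Matrix.mul_add, ← hP, hJ]
  have h6 : J * (P⁻¹ * ι) * ρ = (1 - J * (P⁻¹ * B)) * J := by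
    rw [Matrix.sub_mul, Matrix.one_mul, eq_sub_iff_add_eq]
    simpa only [Matrix.mul_assoc, add_comm] using h5
  have h7 : J * (P⁻¹ * ι) = 0 := by
    funext j
    refine hinj (((Submodule.Quotient.mk_eq_zero N).2 ?_).trans (map_zero σ).symm)
    exact (congrArg (· ∈ N) (congrFun h6 j)).mpr (hJN _)
  refine ⟨J * P⁻¹, ?_⟩
  have h8 : J * (P⁻¹ * (ι * ρ)) = 0 := by
    rw [← Matrix.mul_assoc P⁻¹, ← Matrix.mul_assoc, h7, Matrix.zero_mul]
  rw [h8, add_zero] at h5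
  rw [Matrix.mul_assoc, h5]

/-! ### Hadamard's lemma -/

section
variable {E F : Type*} [NormedAddCommGroup E] [NormedSpace ℂ E] [NormedAddCommGroup F]
  [NormedSpace ℂ F]

/-- The divided difference in direction `e` of the homogeneous polynomial `v ↦ P (v, …, v)` with
respect to `v` and `π v`: the sum over all `k` of the multilinear maps that feed `π v` into the slots
before `k`, the vector `e` into the slot `k`, and `v` into the slots after `k`. -/
noncomputable def dividedTerm (π : E →L[ℂ] E) (e : E) {m : ℕ} (P : E [×(m + 1)]→L[ℂ] F) :
    E [×m]→L[ℂ] F :=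
  ∑ k : Fin (m + 1), (P.curryMid k e).compContinuousLinearMap
    fun j => if j.castSucc < k then π else .id ℂ E

theorem norm_dividedTerm_le (π : E →L[ℂ] E) (e : E) {m : ℕ} (P : E [×(m + 1)]→L[ℂ] F) :
    ‖dividedTerm π e P‖ ≤ (m + 1) * (‖P‖ * ‖e‖ * (max ‖π‖ 1) ^ m) := by
  refine (norm_sum_le_of_le
    (f := fun k : Fin (m + 1) => (P.curryMid k e).compContinuousLinearMap
      fun j => if j.castSucc < k then π else .id ℂ E)
    (n := fun _ => ‖P‖ * ‖e‖ * (max ‖π‖ 1) ^ m) _ fun k _ => ?_).trans ?_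
  · refine (ContinuousMultilinearMap.norm_compContinuousLinearMap_le _ _).trans ?_
    gcongr
    · exact (ContinuousLinearMap.le_opNorm _ _).trans (by
        rw [ContinuousMultilinearMap.norm_curryMid])
    · refine (Finset.prod_le_prod (fun _ _ => norm_nonneg _) (g := fun _ => max ‖π‖ 1)
        fun j _ => ?_).trans (by simp)
      split_ifs
      · exact le_max_left _ _
      · exact ContinuousLinearMap.norm_id_le.trans (le_max_right _ _)
  · simp

theorem sum_dividedTerm {ι : Type*} [Fintype ι] (π : E →L[ℂ] E) (e : ι → E) (c : ι → ℂ) (v : E)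
    (h : v - π v = ∑ i, c i • e i) {m : ℕ} (P : E [×(m + 1)]→L[ℂ] F) :
    ∑ i, c i • dividedTerm π (e i) P (fun _ => v) = P (fun _ => v) - P (fun _ => π v) := by
  -- the difference telescopes along the arguments with `k` slots `π v` followed by slots `v`
  let a : ℕ → Fin (m + 1) → E := fun k j => if (j : ℕ) < k then π v else v
  have h1 : ∀ k : Fin (m + 1), ∑ i, c i • (P.curryMid k (e i)).compContinuousLinearMap
      (fun j => if j.castSucc < k then π else .id ℂ E) (fun _ => v) = P (a k) - P (a (k + 1)) := by
    intro k
    have h2 : ∀ y, (P.curryMid k y).compContinuousLinearMap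
        (fun j => if j.castSucc < k then π else .id ℂ E) (fun _ => v) =
          P (Function.update (a k) k y) := by
      intro y
      rw [ContinuousMultilinearMap.compContinuousLinearMap_apply,
        ContinuousMultilinearMap.curryMid_apply]
      congr 1
      rw [Fin.insertNth_eq_iff]
      refine ⟨by simp, ?_⟩
      funext j
      have hj := Fin.succAbove_lt_iff_castSucc_lt k j
      rw [Fin.removeNth_apply, Function.update_of_ne (Fin.succAbove_ne k j)]
      by_cases hlt : j.castSucc < k
      · simp [a, hlt, Fin.lt_def.1 (hj.2 hlt)]
      · simp [a, hlt, hj]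
    simp only [h2]
    have h3 := map_sum (P.toMultilinearMap.toLinearMap (a k) k) (fun i => c i • e i) Finset.univ
    simp only [map_smul] at h3
    refine h3.symm.trans ?_
    rw [← h]
    refine (P.map_update_sub (a k) k v (π v)).trans ?_
    congr 2
    · simp [a]
    · funext j
      rcases eq_or_ne j k with rfl | hjk
      · simp [a]
      · have : (j : ℕ) < k ↔ (j : ℕ) < k + 1 := by
          have := Fin.val_ne_of_ne hjk
          omega
        simp only [a, Function.update_of_ne hjk, this]
  simp only [dividedTerm, _root_.sum_apply, Finset.smul_sum]
  rw [Finset.sum_comm, Finset.sum_congr rfl fun k _ => h1 k,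
    Fin.sum_univ_eq_sum_range (fun k => P (a k) - P (a (k + 1))), Finset.sum_range_sub']
  simp [a, Nat.lt_succ_iff.1 (Fin.is_lt _)]

/-- The divided difference of a power series in direction `e`, term by term. -/
noncomputable def dividedSeries (π : E →L[ℂ] E) (e : E) (P : FormalMultilinearSeries ℂ E F) :
    FormalMultilinearSeries ℂ E F :=
  fun m => dividedTerm π e (P (m + 1))

open scoped NNReal in
theorem dividedSeries_radius_pos (π : E →L[ℂ] E) (e : E) {P : FormalMultilinearSeries ℂ E F}
    (hP : 0 < P.radius) : 0 < (dividedSeries π e P).radius := by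
  obtain ⟨r, hr0, hr⟩ := ENNReal.lt_iff_exists_nnreal_btwn.1 hP
  have hr0 : (0 : ℝ) < r := by exact_mod_cast hr0
  obtain ⟨C, hC, hb⟩ := P.norm_mul_pow_le_of_lt_radius hr
  let K : ℝ≥0 := max ‖π‖₊ 1
  have hK : max ‖π‖ 1 = (K : ℝ) := by simp [K]
  have hK0 : (0 : ℝ) < K := by rw [← hK]; positivity
  -- the factor `2` absorbs the number `m + 1 ≤ 2 ^ m` of summands
  let s : ℝ≥0 := r / (2 * K)
  have hs : 0 < s := by
    have : (0 : ℝ) < s := by simp only [s]; push_cast; positivity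
    exact_mod_cast this
  refine lt_of_lt_of_le (by exact_mod_cast hs)
    ((dividedSeries π e P).le_radius_of_bound (C * ‖e‖ / r) (r := s) fun m => ?_)
  have h2 : ((m : ℝ) + 1) ≤ 2 ^ m := by
    have := @Nat.lt_two_pow_self m
    exact_mod_cast this
  have h3 := norm_dividedTerm_le π e (P (m + 1))
  rw [hK] at h3
  calc ‖dividedSeries π e P m‖ * (s : ℝ) ^ m
      ≤ (2 ^ m * (‖P (m + 1)‖ * ‖e‖ * (K : ℝ) ^ m)) * (s : ℝ) ^ m := by
        gcongr
        exact h3.trans (by gcongr)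
    _ = (‖P (m + 1)‖ * (r : ℝ) ^ (m + 1)) * ‖e‖ / r := by
        have : (s : ℝ) = r / (2 * K) := by simp [s]
        rw [this, div_pow, mul_pow]
        field_simp
        ring
    _ ≤ C * ‖e‖ / r := by
        gcongr
        exact hb _

/-- Hadamard's lemma for holomorphic functions: `G (w + v) - G (w + π v)` lies in the ideal generated
by the coordinates of `v - π v`. For `π = 0` this is the first order expansion at `w`; for a
projection `π` it says that functions vanishing on `w + range π` lie in the ideal of that subspace. -/
theorem exists_hadamard {n : ℕ} {G : (Fin n → ℂ) → ℂ} {w : Fin n → ℂ} (hG : AnalyticAt ℂ G w)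
    (π : (Fin n → ℂ) →L[ℂ] (Fin n → ℂ)) :
    ∃ H : Fin n → (Fin n → ℂ) → ℂ, (∀ i, AnalyticAt ℂ (H i) 0) ∧
      ∀ᶠ v in 𝓝 0, G (w + v) - G (w + π v) = ∑ i, (v - π v) i * H i v := by
  obtain ⟨P, hP⟩ := hG
  let q : Fin n → FormalMultilinearSeries ℂ (Fin n → ℂ) ℂ :=
    fun i => dividedSeries π (Pi.single i 1) P
  have hq : ∀ i, HasFPowerSeriesAt (q i).sum (q i) 0 := fun i =>
    ((q i).hasFPowerSeriesOnBall
      (dividedSeries_radius_pos π _ hP.radius_pos)).hasFPowerSeriesAt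
  refine ⟨fun i => (q i).sum, fun i => (hq i).analyticAt, ?_⟩
  have hπ : Tendsto π (𝓝 0) (𝓝 0) := by simpa using π.continuous.tendsto 0
  filter_upwards [hP.eventually_hasSum, hπ.eventually hP.eventually_hasSum,
    eventually_all.2 fun i => (hq i).eventually_hasSum] with v h1 h2 h3
  have h4 : HasSum (fun m => ∑ i, (v - π v) i * q i m fun _ => v)
      (∑ i, (v - π v) i * (q i).sum v) := by
    refine hasSum_sum fun i _ => ?_
    simpa using (h3 i).mul_left ((v - π v) i)
  have h5 : ∀ m, ∑ i, (v - π v) i * q i m (fun _ => v) =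
      P (m + 1) (fun _ => v) - P (m + 1) (fun _ => π v) := fun m =>
    sum_dividedTerm π (fun i : Fin n => Pi.single i (1 : ℂ)) (v - π v) v
      (pi_eq_sum_univ' (v - π v)) (P (m + 1))
  simp only [h5] at h4
  have h6 := (hasSum_nat_add_iff' 1).2 (h1.sub h2)
  -- the constant terms of the two expansions agree
  have h7 : ∑ i ∈ Finset.range 1, (P i (fun _ => v) - P i (fun _ => π v)) = 0 := by
    have h8 : (fun _ : Fin 0 => v) = fun _ => π v := funext fun j => j.elim0
    rw [Finset.sum_range_one, h8, sub_self]
  rw [h7, sub_zero] at h6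
  exact h6.unique h4
end

/-! ### Linear algebra of the Jacobian matrix -/

/-- A matrix `F` over a field has a basis `ι` of its kernel, coordinates `ρ` on the kernel extended to
the whole space, and a matrix `B` such that `B * F` is the projection `1 - ι * ρ` onto a complement
of the kernel. -/
theorem Matrix.exists_generalized_inverse {K : Type*} [Field K] {r n : ℕ}
    (F : Matrix (Fin r) (Fin n) K) :
    ∃ (e : ℕ) (B : Matrix (Fin n) (Fin r) K) (ι : Matrix (Fin n) (Fin e) K)
      (ρ : Matrix (Fin e) (Fin n) K), B * F + ι * ρ = 1 ∧ ρ * ι = 1 ∧ F * ι = 0 ∧ ρ * B = 0 := by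
  let φ := Matrix.toLin' F
  let e := Module.finrank K (LinearMap.ker φ)
  let κ : LinearMap.ker φ ≃ₗ[K] (Fin e → K) := (Module.finBasis K _).equivFun
  obtain ⟨π, hπ⟩ := (LinearMap.ker φ).subtype.exists_leftInverse_of_injective
    (Submodule.ker_subtype _)
  obtain ⟨s, hs⟩ := φ.rangeRestrict.exists_rightInverse_of_surjective φ.range_rangeRestrict
  obtain ⟨τ, hτ⟩ := (LinearMap.range φ).subtype.exists_leftInverse_of_injective
    (Submodule.ker_subtype _)
  let ρ := κ.toLinearMap ∘ₗ π
  let ι := (LinearMap.ker φ).subtype ∘ₗ κ.symm.toLinearMap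
  have hπ' : ∀ v : LinearMap.ker φ, π v = v := fun v => LinearMap.congr_fun hπ v
  have hρι : ρ ∘ₗ ι = LinearMap.id := by
    ext1; ext1
    simp [ρ, ι, hπ']
  have hι : ∀ t, φ (ι t) = 0 := fun t => (κ.symm t).2
  have hq : ∀ v, φ v = 0 → ι (ρ v) = v := by
    intro v hv
    have h1 : π v = ⟨v, hv⟩ := hπ' ⟨v, hv⟩
    simp [ι, ρ, h1]
  let B := (LinearMap.id - ι ∘ₗ ρ) ∘ₗ s ∘ₗ τ
  have hB : B ∘ₗ φ + ι ∘ₗ ρ = LinearMap.id := by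
    refine LinearMap.ext fun v => ?_
    have h1 : τ (φ v) = φ.rangeRestrict v := LinearMap.congr_fun hτ (φ.rangeRestrict v)
    have h2 : φ (s (φ.rangeRestrict v)) = φ v :=
      congrArg Subtype.val (LinearMap.congr_fun hs (φ.rangeRestrict v))
    have h3 := hq (v - s (φ.rangeRestrict v)) (by rw [map_sub, h2, sub_self])
    simp only [map_sub] at h3
    simp only [B, LinearMap.add_apply, LinearMap.comp_apply, LinearMap.sub_apply,
      LinearMap.id_apply, h1]
    rw [sub_eq_iff_eq_add] at h3
    rw [h3]
    abel
  have hρB : ρ ∘ₗ B = 0 := by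
    simp only [B, ← LinearMap.comp_assoc, LinearMap.comp_sub, hρι]
    simp
  have hF : F = LinearMap.toMatrix' φ := (LinearMap.toMatrix'_toLin' F).symm
  refine ⟨e, LinearMap.toMatrix' B, LinearMap.toMatrix' ι, LinearMap.toMatrix' ρ, ?_, ?_, ?_, ?_⟩
  · rw [hF, ← LinearMap.toMatrix'_comp, ← LinearMap.toMatrix'_comp, ← map_add, hB,
      LinearMap.toMatrix'_id]
  · rw [← LinearMap.toMatrix'_comp, hρι, LinearMap.toMatrix'_id]
  · rw [hF, ← LinearMap.toMatrix'_comp, LinearMap.ext (f := φ ∘ₗ ι) (g := 0) hι, map_zero]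
  · rw [← LinearMap.toMatrix'_comp, hρB, map_zero]

/-! ### Germs of holomorphic functions and stalks of the structure sheaf -/

theorem holGerm_eq_iff {n : ℕ} {y : Fin n → ℂ} {g h : (Fin n → ℂ) → ℂ} {hg : AnalyticAt ℂ g y}
    {hh : AnalyticAt ℂ h y} : holGerm g hg = holGerm h hh ↔ g =ᶠ[𝓝 y] h :=
  Subtype.ext_iff.trans Germ.coe_eq

theorem exists_eq_holGerm {n : ℕ} {y : Fin n → ℂ} (a : holGerms y) :
    ∃ g, ∃ hg : AnalyticAt ℂ g y, holGerm g hg = a := by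
  obtain ⟨_, g, hg, rfl⟩ := a
  exact ⟨g, hg, rfl⟩

theorem holGerm_add {n : ℕ} {y : Fin n → ℂ} {g h : (Fin n → ℂ) → ℂ} (hg : AnalyticAt ℂ g y)
    (hh : AnalyticAt ℂ h y) : holGerm g hg + holGerm h hh = holGerm (g + h) (hg.add hh) := rfl

theorem algebraMap_holGerms {n : ℕ} {y : Fin n → ℂ} (c : ℂ) :
    algebraMap ℂ (holGerms y) c = holGerm (fun _ => c) analyticAt_const := by
  refine Subtype.ext ?_
  change algebraMap ℂ (Germ (𝓝 y) ℂ) c = _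
  rw [Algebra.algebraMap_eq_smul_one, ← Germ.coe_one, ← Germ.coe_smul]
  exact congrArg _ (funext fun z => by simp)

theorem holGerm_sum {ι : Type*} {n : ℕ} {y : Fin n → ℂ} (s : Finset ι)
    (g : ι → (Fin n → ℂ) → ℂ)
    (hg : ∀ i, AnalyticAt ℂ (g i) y) :
    ∑ i ∈ s, holGerm (g i) (hg i) =
      holGerm (fun z => ∑ i ∈ s, g i z) (Finset.analyticAt_fun_sum s fun i _ => hg i) := by
  classical
  induction s using Finset.induction_on with
  | empty => simpa using algebraMap_holGerms (y := y) 0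
  | insert a s ha ih =>
    rw [Finset.sum_insert ha, ih, holGerm_add, holGerm_eq_iff]
    exact Eventually.of_forall fun z => by simp [Finset.sum_insert ha]

namespace AnalyticModel

variable {n r : ℕ} {X : AnalyticModel n r} {y : X.Pt}

theorem exists_eq_germ (a : X.Stalk y) : ∃ g, ∃ hg : AnalyticAt ℂ g y.1, X.germ g hg = a := by
  obtain ⟨b, rfl⟩ := Ideal.Quotient.mk_surjective (I := X.ideal y) a
  obtain ⟨g, hg, rfl⟩ := exists_eq_holGerm b
  exact ⟨g, hg, rfl⟩

theorem germ_mul {g h : (Fin n → ℂ) → ℂ} (hg : AnalyticAt ℂ g y) (hh : AnalyticAt ℂ h y) :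
    X.germ g hg * X.germ h hh = X.germ (fun z => g z * h z) (hg.mul hh) := rfl

theorem algebraMap_stalk (c : ℂ) :
    algebraMap ℂ (X.Stalk y) c = X.germ (fun _ => c) analyticAt_const :=
  congrArg (X.proj y) (algebraMap_holGerms c)

theorem germ_sum {ι : Type*} (s : Finset ι) (g : ι → (Fin n → ℂ) → ℂ)
    (hg : ∀ i, AnalyticAt ℂ (g i) y) :
    ∑ i ∈ s, X.germ (g i) (hg i) =
      X.germ (fun z => ∑ i ∈ s, g i z) (Finset.analyticAt_fun_sum s fun i _ => hg i) := by
  simp only [germ, ← holGerm_sum s g hg, map_sum]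

theorem germ_eq_iff {g h : (Fin n → ℂ) → ℂ} {hg : AnalyticAt ℂ g y} {hh : AnalyticAt ℂ h y} :
    X.germ g hg = X.germ h hh ↔ ∃ b : Fin r → (Fin n → ℂ) → ℂ, (∀ j, AnalyticAt ℂ (b j) y) ∧
      ∀ᶠ z in 𝓝 y.1, g z = h z + ∑ j, b j z * X.f j z := by
  have h1 : ∀ (b : Fin r → (Fin n → ℂ) → ℂ) (hb : ∀ j, AnalyticAt ℂ (b j) y),
      ∑ j, holGerm (b j) (hb j) * holGerm (X.f j) (X.analyticAt j y) + holGerm h hh =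
      holGerm (fun z => h z + ∑ j, b j z * X.f j z) (hh.add (Finset.analyticAt_fun_sum _
        fun j _ => (hb j).mul (X.analyticAt j y))) := by
    intro b hb
    rw [add_comm]
    exact congrArg (holGerm h hh + ·) (holGerm_sum Finset.univ (fun j z => b j z * X.f j z)
      fun j => (hb j).mul (X.analyticAt j y))
  rw [show X.germ g hg = X.germ h hh ↔ holGerm g hg - holGerm h hh ∈ X.ideal y from
    Ideal.Quotient.eq, ideal, Ideal.mem_span_range_iff_exists_fun]
  constructor
  · rintro ⟨c, hc⟩
    choose b hb hbc using fun j => exists_eq_holGerm (c j)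
    refine ⟨b, hb, ?_⟩
    simp only [← hbc] at hc
    rw [eq_sub_iff_add_eq, h1, eq_comm, holGerm_eq_iff] at hc
    exact hc
  · rintro ⟨b, hb, hz⟩
    refine ⟨fun j => holGerm (b j) (hb j), ?_⟩
    rw [eq_sub_iff_add_eq, h1, eq_comm, holGerm_eq_iff]
    exact hz

theorem germ_congr {g h : (Fin n → ℂ) → ℂ} (hg : AnalyticAt ℂ g y) (hh : AnalyticAt ℂ h y)
    (hgh : ∀ᶠ z in 𝓝 y.1, g z = h z) : X.germ g hg = X.germ h hh :=
  congrArg (X.proj y) (holGerm_eq_iff.2 hgh)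

theorem germ_f_eq_zero (j : Fin r) : X.germ (X.f j) (X.analyticAt j y) = 0 :=
  Ideal.Quotient.eq_zero_iff_mem.2 (Ideal.subset_span ⟨j, rfl⟩)

variable (X y) in
/-- The residue homomorphism `𝒪_{X, y} → ℂ`, which sends a germ to its value at `y`. -/
def eval : X.Stalk y →+* ℂ :=
  Ideal.Quotient.lift (X.ideal y) (Germ.valueRingHom.comp (holGerms y.1).val.toRingHom) (by
    intro a ha
    refine (Ideal.span_le (I := RingHom.ker (Germ.valueRingHom.comp
      (holGerms y.1).val.toRingHom))).2 ?_ ha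
    rintro _ ⟨j, rfl⟩
    exact y.2.2 j)

theorem eval_germ {g : (Fin n → ℂ) → ℂ} (hg : AnalyticAt ℂ g y) :
    X.eval y (X.germ g hg) = g y.1 := rfl

theorem isUnit_of_eval_ne_zero {a : X.Stalk y} (ha : X.eval y a ≠ 0) : IsUnit a := by
  obtain ⟨g, hg, rfl⟩ := exists_eq_germ a
  have hg0 : g y.1 ≠ 0 := ha
  refine IsUnit.of_mul_eq_one (X.germ (fun z => (g z)⁻¹) (hg.inv hg0)) ?_
  rw [germ_mul, ← map_one (algebraMap ℂ (X.Stalk y)), algebraMap_stalk]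
  refine germ_congr _ _ ?_
  filter_upwards [hg.continuousAt.eventually_ne hg0] with z hz
  exact mul_inv_cancel₀ hz

instance : Nontrivial (X.Stalk y) := (X.eval y).domain_nontrivial

theorem mem_maxIdeal_iff {a : X.Stalk y} : a ∈ X.maxIdeal y ↔ X.eval y a = 0 := by
  constructor
  · refine fun ha => (Ideal.span_le (I := RingHom.ker (X.eval y))).2 ?_ ha
    rintro _ ⟨g, hg, h0, rfl⟩
    exact h0
  · obtain ⟨g, hg, rfl⟩ := exists_eq_germ a
    exact fun h0 => Ideal.subset_span ⟨g, hg, h0, rfl⟩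

end AnalyticModel

/-! ### Kähler differentials and the embedding dimension -/

namespace AnalyticModel

variable {n r : ℕ} {X : AnalyticModel n r} {y : X.Pt}

variable (X y) in
/-- The Jacobian matrix `∂f_j / ∂z_i` of the equations at the point `y`. -/
def jacobian : Matrix (Fin r) (Fin n) ℂ := fun j i => partialDeriv i (X.f j) y.1

open Matrix in
/-- If `Ω^p_{X, y}` is free, then modulo the ideal of `X` the differentials `df_j` are combinations of
the differentials of the functions `B f`. Here `h1`, `h2`, `h3` say that `ι` and `ρ` split off the
kernel of the Jacobian matrix. -/
theorem exists_partialDeriv_eq {e p m : ℕ} {B : Matrix (Fin n) (Fin r) ℂ}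
    {ι : Matrix (Fin n) (Fin e) ℂ} {ρ : Matrix (Fin e) (Fin n) ℂ}
    (h1 : B * X.jacobian y + ι * ρ = 1) (h2 : ρ * ι = 1) (h3 : X.jacobian y * ι = 0)
    (hp : 1 ≤ p) (hpe : p ≤ e) (b : Module.Basis (Fin m) (X.Stalk y) (X.Omega p y)) :
    ∃ (q : Fin r → Fin n → (Fin n → ℂ) → ℂ) (c : Fin r → Fin n → Fin r → (Fin n → ℂ) → ℂ),
      (∀ j l, AnalyticAt ℂ (q j l) y.1) ∧ (∀ j i k, AnalyticAt ℂ (c j i k) y.1) ∧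
      ∀ j i, ∀ᶠ z in 𝓝 y.1, partialDeriv i (X.f j) z =
        ∑ l, q j l z * ∑ k, B l k * partialDeriv i (X.f k) z + ∑ k, c j i k z * X.f k z := by
  let J : Matrix (Fin r) (Fin n) (X.Stalk y) := fun j => X.ambientD (X.f j) (X.analyticAt j y)
  let a : ℂ →+* X.Stalk y := algebraMap ℂ _
  have hJ : J.map (X.eval y) = X.jacobian y := rfl
  have ha : ∀ {s t : ℕ} (C : Matrix (Fin s) (Fin t) ℂ), (C.map a).map (X.eval y) = C := by
    intro s t C
    ext i j
    simp only [Matrix.map_apply, a, algebraMap_stalk, eval_germ]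
  obtain ⟨Q, hQ⟩ := exists_eq_mul_of_basis_exteriorPower (X.eval y)
    (fun _ => isUnit_of_eval_ne_zero) J (B.map a) (ι.map a) (ρ.map a)
    (by rw [Matrix.map_add _ (map_add _), Matrix.map_mul, Matrix.map_mul, ha, ha, ha, hJ, h1])
    (by rw [Matrix.map_mul, ha, ha, h2]) (by rw [Matrix.map_mul, ha, hJ, h3]) hp hpe b
  choose q hq hqQ using fun j l => exists_eq_germ (Q j l)
  have h4 : ∀ j i, ∃ c : Fin r → (Fin n → ℂ) → ℂ, (∀ k, AnalyticAt ℂ (c k) y.1) ∧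
      ∀ᶠ z in 𝓝 y.1, partialDeriv i (X.f j) z =
        ∑ l, q j l z * ∑ k, B l k * partialDeriv i (X.f k) z + ∑ k, c k z * X.f k z := by
    intro j i
    have h5 : ∀ k, AnalyticAt ℂ (partialDeriv i (X.f k)) y.1 := fun k =>
      analyticAt_partialDeriv i (X.analyticAt k y)
    have h6 : ∀ l, AnalyticAt ℂ (fun z => ∑ k, B l k * partialDeriv i (X.f k) z) y.1 := fun l =>
      Finset.analyticAt_fun_sum _ fun k _ => analyticAt_const.mul (h5 k)
    refine (germ_eq_iff (hg := h5 j) (hh := Finset.analyticAt_fun_sum _ fun l _ =>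
      (hq j l).mul (h6 l))).1 ?_
    refine (congrFun (congrFun hQ j) i).trans (Eq.trans ?_
      (germ_sum _ (fun l z => q j l z * ∑ k, B l k * partialDeriv i (X.f k) z)
        fun l => (hq j l).mul (h6 l)))
    rw [Matrix.mul_apply]
    refine Finset.sum_congr rfl fun l _ => ?_
    rw [← germ_mul (hq j l) (h6 l), hqQ, Matrix.mul_apply,
      ← germ_sum _ (fun k z => B l k * partialDeriv i (X.f k) z)
      fun k => analyticAt_const.mul (h5 k)]
    congr 1
    refine Finset.sum_congr rfl fun k _ => ?_
    rw [← germ_mul analyticAt_const (h5 k), ← algebraMap_stalk]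
    rfl
  choose c hc hcz using h4
  exact ⟨q, c, hq, hc, hcz⟩

open Matrix in
/-- The embedding dimension is at most the corank of the Jacobian matrix: the coordinates span
`𝔪_y / 𝔪_y²`, and the differentials of the equations are relations between them. -/
theorem embDim_le {e : ℕ} {B : Matrix (Fin n) (Fin r) ℂ}
    {ι : Matrix (Fin n) (Fin e) ℂ} {ρ : Matrix (Fin e) (Fin n) ℂ}
    (h1 : B * X.jacobian y + ι * ρ = 1) : X.embDim y ≤ e := by
  have hz : ∀ i : Fin n, AnalyticAt ℂ (fun z : Fin n → ℂ => z i - y.1 i) y.1 := fun i =>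
    ((ContinuousLinearMap.proj (R := ℂ) (φ := fun _ : Fin n => ℂ) i).analyticAt _).sub
      analyticAt_const
  let ζ : Fin n → X.maxIdeal y := fun i => ⟨X.germ _ (hz i), mem_maxIdeal_iff.2 (sub_self _)⟩
  let ξ : Fin n → (X.maxIdeal y).Cotangent := fun i => (X.maxIdeal y).toCotangent (ζ i)
  -- the class of a function is its differential
  have key : ∀ (g : (Fin n → ℂ) → ℂ) (hg : AnalyticAt ℂ g y.1) (h0 : g y.1 = 0),
      (X.maxIdeal y).toCotangent ⟨X.germ g hg, mem_maxIdeal_iff.2 h0⟩ =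
        ∑ i, partialDeriv i g y.1 • ξ i := by
    intro g hg h0
    obtain ⟨H, hH, hHv⟩ := exists_hadamard hg 0
    have hsub : Tendsto (fun z : Fin n → ℂ => z - y.1) (𝓝 y.1) (𝓝 0) :=
      Continuous.tendsto' (by fun_prop) _ _ (sub_self _)
    have hH' : ∀ i, AnalyticAt ℂ (fun z => H i (z - y.1)) y.1 := fun i =>
      AnalyticAt.comp_of_eq (hH i) (analyticAt_id.sub analyticAt_const) (sub_self _)
    have hgz : ∀ᶠ z in 𝓝 y.1, g z = ∑ i, (z i - y.1 i) * H i (z - y.1) := by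
      filter_upwards [hsub.eventually hHv] with z hz
      simpa [h0] using hz
    have hd : ∀ l, partialDeriv l g y.1 = H l 0 := by
      intro l
      have h1 := HasFDerivAt.fun_sum (u := Finset.univ) fun i _ =>
        (hz i).differentiableAt.hasFDerivAt.mul (hH' i).differentiableAt.hasFDerivAt
      rw [partialDeriv, (h1.congr_of_eventuallyEq hgz).fderiv]
      have h2 : ∀ i, fderiv ℂ (fun z : Fin n → ℂ => z i - y.1 i) y.1 =
          ContinuousLinearMap.proj i := fun i =>
        ((ContinuousLinearMap.proj (R := ℂ) (φ := fun _ : Fin n => ℂ) i).hasFDerivAt.sub_const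
          _).fderiv
      simp [h2, Pi.single_apply]
    have hsmul : ∀ (a : X.Stalk y) (t : (X.maxIdeal y).Cotangent), a • t = X.eval y a • t := by
      intro a t
      have h1 : a - algebraMap ℂ (X.Stalk y) (X.eval y a) ∈ X.maxIdeal y := by
        rw [mem_maxIdeal_iff, map_sub, algebraMap_stalk, eval_germ, sub_self]
      have h2 := Ideal.Cotangent.smul_eq_zero_of_mem h1 t
      rwa [sub_smul, sub_eq_zero, algebraMap_smul] at h2
    have hsum : (⟨X.germ g hg, mem_maxIdeal_iff.2 h0⟩ : X.maxIdeal y) =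
        ∑ i, X.germ _ (hH' i) • ζ i := by
      refine Subtype.ext ?_
      rw [AddSubmonoidClass.coe_finsetSum]
      refine (germ_congr hg (Finset.analyticAt_fun_sum _ fun i _ => (hz i).mul (hH' i))
        hgz).trans ((germ_sum Finset.univ (fun i z => (z i - y.1 i) * H i (z - y.1))
          fun i => (hz i).mul (hH' i)).symm.trans ?_)
      exact Finset.sum_congr rfl fun i _ => mul_comm (X.germ _ (hz i)) (X.germ _ (hH' i))
    rw [hsum, map_sum]
    refine Finset.sum_congr rfl fun i _ => ?_
    rw [map_smul, hsmul, eval_germ, hd, sub_self]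
  let Ξ : (Fin n → ℂ) →ₗ[ℂ] (X.maxIdeal y).Cotangent := Fintype.linearCombination ℂ ξ
  have hΞ : ∀ c, Ξ c = ∑ i, c i • ξ i := fun c => Fintype.linearCombination_apply _ _ _
  have hf : ∀ j, Ξ (X.jacobian y j) = 0 := by
    intro j
    rw [hΞ, ← (X.maxIdeal y).toCotangent.map_zero]
    refine (key (X.f j) (X.analyticAt j y) (y.2.2 j)).symm.trans (congrArg _ ?_)
    exact Subtype.ext (germ_f_eq_zero j)
  have hsurj : Function.Surjective (Ξ ∘ₗ ρ.vecMulLinear) := by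
    intro t
    obtain ⟨⟨a, ha⟩, rfl⟩ := (X.maxIdeal y).toCotangent_surjective t
    obtain ⟨g, hg, rfl⟩ := exists_eq_germ a
    let c : Fin n → ℂ := fun i => partialDeriv i g y.1
    refine ⟨c ᵥ* ι, ?_⟩
    rw [key g hg (mem_maxIdeal_iff.1 ha), ← hΞ c]
    have h2 : c = (c ᵥ* B) ᵥ* X.jacobian y + (c ᵥ* ι) ᵥ* ρ := by
      rw [vecMul_vecMul, vecMul_vecMul, ← vecMul_add, h1, vecMul_one]
    conv_rhs => rw [h2, map_add, vecMul_eq_sum (c ᵥ* B), map_sum]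
    simp [hf]
  have h3 := (Ξ ∘ₗ ρ.vecMulLinear).finrank_le_finrank_of_surjective hsurj
  simpa [embDim] using h3

end AnalyticModel

/-! ### Analytic tools -/

/-- A solution of a homogeneous linear differential inequality on a ball vanishes if it vanishes at
the centre: apply Grönwall's inequality along the rays. -/
theorem eq_zero_of_norm_fderiv_le {E F : Type*} [NormedAddCommGroup E] [NormedSpace ℂ E]
    [NormedAddCommGroup F] [NormedSpace ℂ F] {h : E → F} {h' : E → E →L[ℂ] F} {t₀ : E} {δ K : ℝ}
    (hh : ∀ t ∈ Metric.ball t₀ δ, HasFDerivAt h (h' t) t)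
    (hK : ∀ t ∈ Metric.ball t₀ δ, ‖h' t‖ ≤ K * ‖h t‖) (h0 : h t₀ = 0) :
    ∀ t ∈ Metric.ball t₀ δ, h t = 0 := by
  intro t ht
  let γ : ℝ → E := AffineMap.lineMap t₀ t
  have hγ : ∀ s ∈ Set.Icc (0 : ℝ) 1, γ s ∈ Metric.ball t₀ δ := fun s hs =>
    (convex_ball t₀ δ).lineMap_mem
      (Metric.mem_ball_self (dist_nonneg.trans_lt (Metric.mem_ball.1 ht))) ht hs
  have hd : ∀ s ∈ Set.Icc (0 : ℝ) 1, HasDerivAt (h ∘ γ) (h' (γ s) (t - t₀)) s := fun s hs =>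
    ((hh _ (hγ s hs)).restrictScalars ℝ).comp_hasDerivAt s AffineMap.hasDerivAt_lineMap
  have := eq_zero_of_abs_deriv_le_mul_abs_self_of_eq_zero_right (K := K * ‖t - t₀‖)
    (fun s hs => (hd s hs).continuousAt.continuousWithinAt)
    (fun s hs => (hd s (Set.Ico_subset_Icc_self hs)).hasDerivWithinAt)
    (by simp [γ, h0]) (fun s hs => by
      refine ((h' (γ s)).le_opNorm _).trans ?_
      rw [mul_right_comm]
      gcongr
      exact hK _ (hγ s (Set.Ico_subset_Icc_self hs))) 1 (by simp)
  simpa [γ] using this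

/-- The holomorphic inverse function theorem, with the inverse holomorphic on the whole target and
the source contained in a given neighbourhood. -/
theorem AnalyticAt.exists_openPartialHomeomorph {E : Type*} [NormedAddCommGroup E]
    [NormedSpace ℂ E] [CompleteSpace E] {G : E → E} {x : E} (hG : AnalyticAt ℂ G x)
    (i : E ≃L[ℂ] E) (hi : HasFDerivAt G (i : E →L[ℂ] E) x) {s : Set E} (hs : s ∈ 𝓝 x) :
    ∃ Φ : OpenPartialHomeomorph E E, (Φ : E → E) = G ∧ x ∈ Φ.source ∧ Φ.source ⊆ s ∧
      ∀ z ∈ Φ.source, AnalyticAt ℂ Φ z ∧ AnalyticAt ℂ Φ.symm (Φ z) := by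
  have hstrict : HasStrictFDerivAt G (i : E →L[ℂ] E) x := hi.fderiv ▸ hG.hasStrictFDerivAt
  have h1 : ∀ᶠ z in 𝓝 x, fderiv ℂ G z ∈ Set.range ((↑) : (E ≃L[ℂ] E) → E →L[ℂ] E) :=
    hG.fderiv.continuousAt.eventually
      (by rw [hi.fderiv]; exact ContinuousLinearEquiv.isOpen.mem_nhds ⟨i, rfl⟩)
  obtain ⟨V, hV, hVo, hxV⟩ := eventually_nhds_iff.1
    (h1.and (hG.eventually_analyticAt.and hs))
  let Φ := (hstrict.toOpenPartialHomeomorph G).restrOpen V hVo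
  refine ⟨Φ, rfl, ⟨hstrict.mem_toOpenPartialHomeomorph_source, hxV⟩,
    fun z hz => (hV z hz.2).2.2, fun z hz => ⟨(hV z hz.2).2.1, ?_⟩⟩
  obtain ⟨j, hj⟩ := (hV z hz.2).1
  exact Φ.analyticAt_symm' hz (hV z hz.2).2.1 hj.symm

theorem fderiv_apply_eq_sum_partialDeriv {n : ℕ} (g : (Fin n → ℂ) → ℂ) (z v : Fin n → ℂ) :
    fderiv ℂ g z v = ∑ i, v i * partialDeriv i g z := by
  conv_lhs => rw [pi_eq_sum_univ' v, map_sum]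
  simp [partialDeriv]

/-! ### The submanifold cut out by independent equations -/

namespace AnalyticModel

open Matrix

variable {n r : ℕ} {X : AnalyticModel n r} {y : X.Pt}

theorem hasFDerivAt_f {z : Fin n → ℂ} (hz : z ∈ X.U) :
    HasFDerivAt (fun z k => X.f k z) (ContinuousLinearMap.pi fun k => fderiv ℂ (X.f k) z) z :=
  hasFDerivAt_pi.2 fun k => (X.analytic k z hz).differentiableAt.hasFDerivAt

/-- If the `df_j` are combinations of the `d(B f)_l` modulo the ideal of `X`, then all equations `f_j`
vanish along any parametrization `ψ` through `y` of `B f = 0`: the functions `f_j ∘ ψ` satisfy a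
homogeneous linear differential equation. -/
theorem eventually_comp_eq_zero {e : ℕ} {B : Matrix (Fin n) (Fin r) ℂ}
    {q : Fin r → Fin n → (Fin n → ℂ) → ℂ} {c : Fin r → Fin n → Fin r → (Fin n → ℂ) → ℂ}
    (hc : ∀ j i k, AnalyticAt ℂ (c j i k) y.1)
    (hqc : ∀ j i, ∀ᶠ z in 𝓝 y.1, partialDeriv i (X.f j) z =
      ∑ l, q j l z * ∑ k, B l k * partialDeriv i (X.f k) z + ∑ k, c j i k z * X.f k z)
    {ψ : (Fin e → ℂ) → Fin n → ℂ} {t₀ : Fin e → ℂ} (hψ : AnalyticAt ℂ ψ t₀) (hψ0 : ψ t₀ = y.1)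
    (hB : ∀ᶠ t in 𝓝 t₀, B *ᵥ (fun k => X.f k (ψ t)) = 0) :
    ∀ᶠ t in 𝓝 t₀, ∀ k, X.f k (ψ t) = 0 := by
  let L := ‖fderiv ℂ ψ t₀‖ + 1
  let K := ∑ j, ∑ i, ∑ k, L * (‖c j i k y.1‖ + 1)
  have hL0 : 0 ≤ L := add_nonneg (norm_nonneg _) zero_le_one
  have hM0 : ∀ j i k, 0 ≤ L * (‖c j i k y.1‖ + 1) := fun j i k =>
    mul_nonneg hL0 (add_nonneg (norm_nonneg _) zero_le_one)
  have hM1 : ∀ j, 0 ≤ ∑ i, ∑ k, L * (‖c j i k y.1‖ + 1) := fun j =>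
    Finset.sum_nonneg fun i _ => Finset.sum_nonneg fun k _ => hM0 j i k
  have hK0 : 0 ≤ K := Finset.sum_nonneg fun j _ => hM1 j
  have hlim : Tendsto ψ (𝓝 t₀) (𝓝 y.1) := hψ0 ▸ hψ.continuousAt
  have hL : ∀ᶠ t in 𝓝 t₀, ‖fderiv ℂ ψ t‖ < L :=
    hψ.fderiv.continuousAt.norm.eventually_lt_const (lt_add_one _)
  have hcL : ∀ᶠ z in 𝓝 y.1, ∀ j i k, ‖c j i k z‖ < ‖c j i k y.1‖ + 1 :=
    eventually_all.2 fun j => eventually_all.2 fun i => eventually_all.2 fun k =>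
      (hc j i k).continuousAt.norm.eventually_lt_const (lt_add_one _)
  have hU : ∀ᶠ z in 𝓝 y.1, z ∈ X.U := X.U.isOpen.mem_nhds y.2.1
  obtain ⟨δ, hδ, hball⟩ := Metric.eventually_nhds_iff_ball.1
    (hL.and (hψ.eventually_analyticAt.and (hB.eventually_nhds.and
      (hlim.eventually (hcL.and (hU.and (eventually_all.2 fun j => eventually_all.2 (hqc j))))))))
  let h : (Fin e → ℂ) → Fin r → ℂ := fun t k => X.f k (ψ t)
  let h' : (Fin e → ℂ) → (Fin e → ℂ) →L[ℂ] Fin r → ℂ := fun t =>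
    (ContinuousLinearMap.pi fun k => fderiv ℂ (X.f k) (ψ t)).comp (fderiv ℂ ψ t)
  have hd : ∀ t ∈ Metric.ball t₀ δ, HasFDerivAt h (h' t) t := fun t ht => by
    obtain ⟨-, h2, -, -, h5, -⟩ := hball t ht
    exact (hasFDerivAt_f h5).comp t h2.differentiableAt.hasFDerivAt
  have hbound : ∀ t ∈ Metric.ball t₀ δ, ‖h' t‖ ≤ K * ‖h t‖ := by
    intro t ht
    obtain ⟨h1, h2, h3, h4, h5, h6⟩ := hball t ht
    refine ContinuousLinearMap.opNorm_le_bound _ (mul_nonneg hK0 (norm_nonneg _)) fun v =>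
      (pi_norm_le_iff_of_nonneg
        (mul_nonneg (mul_nonneg hK0 (norm_nonneg _)) (norm_nonneg _))).2 fun j => ?_
    set w := fderiv ℂ ψ t v with hw
    -- the combinations `B f` vanish along `ψ`, and so do their derivatives
    have h7 : ∀ l, ∑ k, B l k * fderiv ℂ (X.f k) (ψ t) w = 0 := by
      intro l
      have h8 : HasFDerivAt (fun t => B.mulVecLin.toContinuousLinearMap (h t))
          (B.mulVecLin.toContinuousLinearMap ∘L h' t) t :=
        B.mulVecLin.toContinuousLinearMap.hasFDerivAt.comp t (hd t ht)
      have h9 := h8.unique ((hasFDerivAt_const (0 : Fin n → ℂ) t).congr_of_eventuallyEq h3)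
      exact congrFun (DFunLike.congr_fun h9 v) l
    have h10 : h' t v j = ∑ i, w i * ∑ k, c j i k (ψ t) * h t k := by
      have h11 : ∀ i, w i * partialDeriv i (X.f j) (ψ t) =
          ∑ l, q j l (ψ t) * ∑ k, B l k * (w i * partialDeriv i (X.f k) (ψ t)) +
            w i * ∑ k, c j i k (ψ t) * h t k := by
        intro i
        rw [h6 j i, mul_add, Finset.mul_sum]
        congr 1
        refine Finset.sum_congr rfl fun l _ => ?_
        rw [mul_left_comm, Finset.mul_sum]
        congr 1
        exact Finset.sum_congr rfl fun k _ => mul_left_comm _ _ _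
      change fderiv ℂ (X.f j) (ψ t) w = _
      rw [fderiv_apply_eq_sum_partialDeriv, Finset.sum_congr rfl fun i _ => h11 i,
        Finset.sum_add_distrib, add_eq_right, Finset.sum_comm]
      refine Finset.sum_eq_zero fun l _ => ?_
      rw [← Finset.mul_sum, Finset.sum_comm]
      simp only [← Finset.mul_sum, ← fderiv_apply_eq_sum_partialDeriv]
      rw [h7, mul_zero]
    have hwL : ‖w‖ ≤ L * ‖v‖ :=
      ((fderiv ℂ ψ t).le_opNorm v).trans (by gcongr)
    rw [h10]
    calc ‖∑ i, w i * ∑ k, c j i k (ψ t) * h t k‖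
        ≤ ∑ i, ‖w‖ * ∑ k, (‖c j i k y.1‖ + 1) * ‖h t‖ := by
          refine norm_sum_le_of_le _ fun i _ => ?_
          rw [norm_mul]
          gcongr
          · exact norm_le_pi_norm w i
          · refine norm_sum_le_of_le _ fun k _ => ?_
            rw [norm_mul]
            gcongr
            · exact (h4 j i k).le
            · exact norm_le_pi_norm (h t) k
      _ ≤ ∑ i, (L * ‖v‖) * ∑ k, (‖c j i k y.1‖ + 1) * ‖h t‖ := by gcongr
      _ = (∑ i, ∑ k, L * (‖c j i k y.1‖ + 1)) * ‖h t‖ * ‖v‖ := by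
          simp only [Finset.mul_sum, Finset.sum_mul]
          exact Finset.sum_congr rfl fun i _ => Finset.sum_congr rfl fun k _ => by ring
      _ ≤ K * ‖h t‖ * ‖v‖ := by
          gcongr
          exact Finset.single_le_sum (f := fun j => ∑ i, ∑ k, L * (‖c j i k y.1‖ + 1))
            (fun j _ => hM1 j) (Finset.mem_univ j)
  have hz := eq_zero_of_norm_fderiv_le hd hbound (by
    funext k
    exact (congrArg (X.f k) hψ0).trans (y.2.2 k))
  filter_upwards [Metric.ball_mem_nhds t₀ hδ] with t ht k
  exact congrFun (hz t ht) k

variable (X) in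
/-- The map `z ↦ B f(z) + C z`. For suitable `B` and `C` it is a local coordinate change that makes
the equations `B f` linear. -/
def straighten (B : Matrix (Fin n) (Fin r) ℂ) (C : Matrix (Fin n) (Fin n) ℂ) (z : Fin n → ℂ) :
    Fin n → ℂ :=
  B *ᵥ (fun k => X.f k z) + C *ᵥ z

theorem analyticAt_straighten {B : Matrix (Fin n) (Fin r) ℂ} {C : Matrix (Fin n) (Fin n) ℂ}
    {z : Fin n → ℂ} (hz : z ∈ X.U) : AnalyticAt ℂ (X.straighten B C) z :=
  ((B.mulVecLin.toContinuousLinearMap.analyticAt _).comp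
    (AnalyticAt.pi fun k => X.analytic k z hz)).add (C.mulVecLin.toContinuousLinearMap.analyticAt _)

theorem hasFDerivAt_straighten {B : Matrix (Fin n) (Fin r) ℂ} {C : Matrix (Fin n) (Fin n) ℂ}
    (h : B * X.jacobian y + C = 1) :
    HasFDerivAt (X.straighten B C)
      ((ContinuousLinearEquiv.refl ℂ (Fin n → ℂ) : (Fin n → ℂ) ≃L[ℂ] (Fin n → ℂ)) :
        (Fin n → ℂ) →L[ℂ] (Fin n → ℂ)) y.1 := by
  have h1 := (B.mulVecLin.toContinuousLinearMap.hasFDerivAt.comp y.1 (hasFDerivAt_f y.2.1)).add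
    (C.mulVecLin.toContinuousLinearMap.hasFDerivAt (x := y.1))
  refine h1.congr_fderiv (ContinuousLinearMap.ext fun v => ?_)
  have h2 : (fun k => fderiv ℂ (X.f k) y.1 v) = X.jacobian y *ᵥ v := by
    funext k
    rw [fderiv_apply_eq_sum_partialDeriv]
    exact Finset.sum_congr rfl fun i _ => mul_comm _ _
  change B *ᵥ (fun k => fderiv ℂ (X.f k) y.1 v) + C *ᵥ v = v
  rw [h2, mulVec_mulVec, ← add_mulVec, h, one_mulVec]

end AnalyticModel

/-! ### The chart -/

/-- The homomorphism `𝒪_{ℂᵐ, a(y)} → 𝒪_{ℂⁿ, y}`, `h ↦ h ∘ a`, for a map `a` holomorphic at `y`. -/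
def holGermsPullback {n m : ℕ} {y : Fin n → ℂ} (a : (Fin n → ℂ) → Fin m → ℂ)
    (ha : AnalyticAt ℂ a y) : holGerms (a y) →ₐ[ℂ] holGerms y where
  toFun b := ⟨b.1.compTendsto a ha.continuousAt, by
    obtain ⟨_, g, hg, rfl⟩ := b
    exact ⟨g ∘ a, hg.comp ha, rfl⟩⟩
  map_one' := rfl
  map_zero' := rfl
  map_mul' b c := by
    obtain ⟨_, g, hg, rfl⟩ := b
    obtain ⟨_, h, hh, rfl⟩ := c
    rfl
  map_add' b c := by
    obtain ⟨_, g, hg, rfl⟩ := b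
    obtain ⟨_, h, hh, rfl⟩ := c
    rfl
  commutes' c := by
    rw [algebraMap_holGerms, algebraMap_holGerms]
    rfl

namespace AnalyticModel

open Matrix

variable {n r : ℕ} {X : AnalyticModel n r} {x : X.Pt}

/-- If all equations vanish on the submanifold `B f = 0`, parametrized by `t ↦ Φ⁻¹ (ι t)`, then `X` is
smooth at `x`, with chart `ρ`. In the coordinates `Φ` the equations `B f` become the linear map
`w ↦ w - ι ρ w`, so that Hadamard's lemma identifies the ideal of functions vanishing on the
submanifold with the ideal of `X`, at every point near `x`. -/
theorem isSmoothAt_of_parametrization {e : ℕ} {B : Matrix (Fin n) (Fin r) ℂ}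
    {ι : Matrix (Fin n) (Fin e) ℂ} {ρ : Matrix (Fin e) (Fin n) ℂ} (hρι : ρ * ι = 1)
    (hρB : ρ * B = 0) (Φ : OpenPartialHomeomorph (Fin n → ℂ) (Fin n → ℂ))
    (hΦ : (Φ : (Fin n → ℂ) → Fin n → ℂ) = X.straighten B (ι * ρ)) (hx : x.1 ∈ Φ.source)
    (hsU : Φ.source ⊆ X.U)
    (hΦa : ∀ z ∈ Φ.source, AnalyticAt ℂ Φ z ∧ AnalyticAt ℂ Φ.symm (Φ z))
    (hf : ∀ᶠ t in 𝓝 (ρ *ᵥ x.1), ∀ k, X.f k (Φ.symm (ι *ᵥ t)) = 0) :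
    X.IsSmoothAt x := by
  have hΦz : ∀ z, Φ z = B *ᵥ (fun k => X.f k z) + (ι * ρ) *ᵥ z := fun z => congrFun hΦ z
  have hρΦ : ∀ z, ρ *ᵥ Φ z = ρ *ᵥ z := fun z => by
    rw [hΦz, mulVec_add, mulVec_mulVec, hρB, mulVec_mulVec, ← Matrix.mul_assoc, hρι,
      zero_mulVec, zero_add, Matrix.one_mul]
  have hΦX : ∀ z : X.Pt, Φ z.1 = ι *ᵥ (ρ *ᵥ z.1) := fun z => by
    have : (fun k => X.f k z.1) = 0 := funext z.2.2
    rw [hΦz, this, mulVec_zero, zero_add, mulVec_mulVec]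
  have hιc : Continuous fun t : Fin e → ℂ => ι *ᵥ t :=
    ι.mulVecLin.toContinuousLinearMap.continuous
  have hρc : Continuous fun z : Fin n → ℂ => ρ *ᵥ z :=
    ρ.mulVecLin.toContinuousLinearMap.continuous
  have hρa : ∀ z, AnalyticAt ℂ (fun z : Fin n → ℂ => ρ *ᵥ z) z :=
    ρ.mulVecLin.toContinuousLinearMap.analyticAt
  let ψ : (Fin e → ℂ) → Fin n → ℂ := fun t => Φ.symm (ι *ᵥ t)
  have hψX : ∀ z : X.Pt, z.1 ∈ Φ.source → ψ (ρ *ᵥ z.1) = z.1 := fun z hz => by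
    simp only [ψ, ← hΦX, Φ.left_inv hz]
  have hρψ : ∀ t, ι *ᵥ t ∈ Φ.target → ρ *ᵥ ψ t = t := fun t ht => by
    rw [← hρΦ, Φ.right_inv ht, mulVec_mulVec, hρι, one_mulVec]
  have htarget : ∀ᶠ t in 𝓝 (ρ *ᵥ x.1), ι *ᵥ t ∈ Φ.target :=
    hιc.continuousAt.eventually_mem
      (Φ.open_target.mem_nhds (by rw [← hΦX]; exact Φ.map_source hx))
  obtain ⟨D, hD, hDo, hxD⟩ := eventually_nhds_iff.1 (htarget.and hf)
  let S : Opens X.Pt := ⟨{z | z.1 ∈ Φ.source ∧ ρ *ᵥ z.1 ∈ D},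
    (Φ.open_source.preimage continuous_subtype_val).inter
      (hDo.preimage (hρc.comp continuous_subtype_val))⟩
  let φ : S ≃ₜ (⟨D, hDo⟩ : Opens (Fin e → ℂ)) :=
    { toFun := fun z => ⟨ρ *ᵥ z.1.1, z.2.2⟩
      invFun := fun t => ⟨⟨ψ t.1, hsU (Φ.map_target (hD t.1 t.2).1), (hD t.1 t.2).2⟩,
        Φ.map_target (hD t.1 t.2).1, by
          change ρ *ᵥ ψ t.1 ∈ D
          rw [hρψ _ (hD t.1 t.2).1]
          exact t.2⟩
      left_inv := fun z => Subtype.ext (Subtype.ext (hψX z.1 z.2.1))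
      right_inv := fun t => Subtype.ext (hρψ t.1 (hD t.1 t.2).1)
      continuous_toFun :=
        (hρc.comp (continuous_subtype_val.comp continuous_subtype_val)).subtype_mk _
      continuous_invFun := by
        refine Continuous.subtype_mk (Continuous.subtype_mk ?_ _) _
        exact Φ.continuousOn_symm.comp_continuous (hιc.comp continuous_subtype_val)
          fun t => (hD t.1 t.2).1 }
  have hψa : ∀ y : S, AnalyticAt ℂ ψ (ρ *ᵥ y.1.1) := fun y => by
    refine AnalyticAt.comp_of_eq (hΦa _ y.2.1).2
      (ι.mulVecLin.toContinuousLinearMap.analyticAt _) ?_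
    exact (hΦX y.1).symm
  have hψlim : ∀ y : S, Tendsto ψ (𝓝 (ρ *ᵥ y.1.1)) (𝓝 y.1.1) := fun y => by
    have := (hψa y).continuousAt.tendsto
    rwa [hψX y.1 y.2.1] at this
  let θ₀ : ∀ y : S, holGerms (ρ *ᵥ y.1.1) →ₐ[ℂ] X.Stalk y.1 := fun y =>
    (X.proj y.1).comp (holGermsPullback (fun z => ρ *ᵥ z) (hρa y.1.1))
  -- pull back along `ψ`, which kills the ideal of `X`
  have hinj : ∀ y : S, Function.Injective (θ₀ y) := by
    intro y
    rw [injective_iff_map_eq_zero]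
    intro a ha
    obtain ⟨h, hh, rfl⟩ := exists_eq_holGerm a
    have h1 : X.germ (y := y.1) (fun z => h (ρ *ᵥ z)) (hh.comp (hρa _)) =
        X.germ (fun _ => 0) analyticAt_const := by
      rw [← algebraMap_stalk, map_zero]
      exact ha
    obtain ⟨b, -, hb⟩ := germ_eq_iff.1 h1
    refine Eq.trans (holGerm_eq_iff (hh := analyticAt_const (v := (0 : ℂ))).2 ?_)
      ((algebraMap_holGerms 0).symm.trans (map_zero _))
    filter_upwards [(hψlim y).eventually hb, hDo.mem_nhds y.2.2] with t ht htD
    rw [hρψ t (hD t htD).1] at ht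
    rw [ht, zero_add]
    exact Finset.sum_eq_zero fun k _ => mul_eq_zero_of_right _ ((hD t htD).2 k)
  -- `g` and `g ∘ ψ ∘ ρ` agree modulo the ideal of `X`
  have hsurj : ∀ y : S, Function.Surjective (θ₀ y) := by
    intro y a
    obtain ⟨g, hg, rfl⟩ := exists_eq_germ a
    have hgψ : AnalyticAt ℂ (fun t => g (ψ t)) (ρ *ᵥ y.1.1) :=
      AnalyticAt.comp_of_eq hg (hψa y) (hψX y.1 y.2.1)
    refine ⟨holGerm _ hgψ, ?_⟩
    refine (germ_eq_iff (hg := hg)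
      (hh := hgψ.comp (hρa y.1.1))).2 ?_ |>.symm
    have hG : AnalyticAt ℂ (fun w => g (Φ.symm w)) (Φ y.1.1) :=
      AnalyticAt.comp_of_eq hg (hΦa _ y.2.1).2 (Φ.left_inv y.2.1)
    obtain ⟨H, hH, hHv⟩ := exists_hadamard hG (ι * ρ).mulVecLin.toContinuousLinearMap
    have hsub : AnalyticAt ℂ (fun z => Φ z - Φ y.1.1) y.1.1 :=
      (hΦa _ y.2.1).1.sub analyticAt_const
    have hH' : ∀ i, AnalyticAt ℂ (fun z => H i (Φ z - Φ y.1.1)) y.1.1 := fun i =>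
      AnalyticAt.comp_of_eq (hH i) hsub (sub_self _)
    refine ⟨fun k z => ∑ i, B i k * H i (Φ z - Φ y.1.1), fun k =>
      Finset.analyticAt_fun_sum _ fun i _ => analyticAt_const.mul (hH' i), ?_⟩
    have hlim : Tendsto (fun z => Φ z - Φ y.1.1) (𝓝 y.1.1) (𝓝 0) := by
      have := hsub.continuousAt.tendsto
      rwa [sub_self] at this
    filter_upwards [hlim.eventually hHv, Φ.open_source.mem_nhds y.2.1] with z hz hzs
    have hπ : (ι * ρ) *ᵥ (Φ z - Φ y.1.1) = (ι * ρ) *ᵥ z - Φ y.1.1 := by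
      rw [mulVec_sub, ← mulVec_mulVec, hρΦ, ← mulVec_mulVec _ ι ρ, hρΦ, ← hΦX, mulVec_mulVec]
    change g (Φ.symm (Φ y.1.1 + (Φ z - Φ y.1.1))) -
      g (Φ.symm (Φ y.1.1 + (ι * ρ) *ᵥ (Φ z - Φ y.1.1))) =
      ∑ i, ((Φ z - Φ y.1.1) - (ι * ρ) *ᵥ (Φ z - Φ y.1.1)) i * H i (Φ z - Φ y.1.1) at hz
    rw [hπ, add_sub_cancel, add_sub_cancel, Φ.left_inv hzs, sub_sub_sub_cancel_right, hΦz z,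
      add_sub_cancel_right, ← hΦz z, ← mulVec_mulVec, sub_eq_iff_eq_add'] at hz
    refine hz.trans (congrArg _ ?_)
    simp only [mulVec, dotProduct, Finset.sum_mul]
    rw [Finset.sum_comm]
    exact Finset.sum_congr rfl fun k _ => Finset.sum_congr rfl fun i _ => mul_right_comm _ _ _
  refine ⟨e, S, ⟨D, hDo⟩, φ, fun y => AlgEquiv.ofBijective (θ₀ y) ⟨hinj y, hsurj y⟩,
    ⟨hx, hxD⟩, fun y h hh => ⟨fun z => h (ρ *ᵥ z), ?_⟩⟩
  have h1 : ∀ᶠ z : S in 𝓝 y, AnalyticAt ℂ h (ρ *ᵥ z.1.1) :=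
    (continuous_subtype_val.comp φ.continuous).continuousAt.eventually hh.eventually_analyticAt
  filter_upwards [h1] with z hz
  exact ⟨hz, AnalyticAt.comp (f := fun z => ρ *ᵥ z) hz (hρa z.1.1), rfl⟩

end AnalyticModel

end

open Matrix in
theorem theorem1p10 (n r : ℕ) (X : AnalyticModel n r) (x : X.Pt) (p : ℕ)
    (hp : 1 ≤ p) (hpe : p ≤ X.embDim x) (hfree : X.IsFreeOmega p x) :
    X.IsSmoothAt x := by
  obtain ⟨S, m, ω, hxS, -, hω⟩ := hfree
  obtain ⟨hli, hspan⟩ := hω ⟨x, hxS⟩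
  obtain ⟨e, B, ι, ρ, h1, h2, h3, h4⟩ := (X.jacobian x).exists_generalized_inverse
  obtain ⟨q, c, -, hc, hqc⟩ := AnalyticModel.exists_partialDeriv_eq h1 h2 h3 hp
    (hpe.trans (AnalyticModel.embDim_le h1)) (Module.Basis.mk hli hspan.ge)
  obtain ⟨Φ, hΦ, hxΦ, hsU, hΦa⟩ :=
    (AnalyticModel.analyticAt_straighten x.2.1).exists_openPartialHomeomorph _
      (AnalyticModel.hasFDerivAt_straighten h1) (X.U.isOpen.mem_nhds x.2.1)
  have hΦx : Φ x.1 = ι *ᵥ (ρ *ᵥ x.1) := by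
    have h5 : (fun k => X.f k x.1) = 0 := funext x.2.2
    rw [hΦ, AnalyticModel.straighten, h5, mulVec_zero, zero_add, mulVec_mulVec]
  refine AnalyticModel.isSmoothAt_of_parametrization h2 h4 Φ hΦ hxΦ hsU hΦa ?_
  have hι : AnalyticAt ℂ (fun t : Fin e → ℂ => ι *ᵥ t) (ρ *ᵥ x.1) :=
    ι.mulVecLin.toContinuousLinearMap.analyticAt _
  refine AnalyticModel.eventually_comp_eq_zero hc hqc
    (AnalyticAt.comp_of_eq (hΦa _ hxΦ).2 hι hΦx.symm) (hΦx ▸ Φ.left_inv hxΦ) ?_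
  filter_upwards [hι.continuousAt.eventually_mem
    (Φ.open_target.mem_nhds (hΦx ▸ Φ.map_source hxΦ))] with t ht
  -- apply `ρ` to `Φ (ψ t) = ι t`, which gives `ρ (ψ t) = t`, and then compare both sides
  have h5 : B *ᵥ (fun k => X.f k (Φ.symm (ι *ᵥ t))) + (ι * ρ) *ᵥ Φ.symm (ι *ᵥ t) = ι *ᵥ t := by
    have h6 := Φ.right_inv ht
    rwa [hΦ] at h6
  have h6 := congrArg (ρ *ᵥ ·) h5
  simp only [mulVec_add, mulVec_mulVec, h4, ← Matrix.mul_assoc, h2, zero_mulVec, zero_add,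
    Matrix.one_mul, one_mulVec] at h6
  rwa [← mulVec_mulVec, h6, add_eq_right] at h5
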